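/- Let $X$ be a finite simple graph. A \emph{module} of $X$ is a nonempty set $M\subseteq V(X)$ such that every vertex outside $M$ is adjacent either to all vertices of $M$ or to none of them; two disjoint modules are \emph{adjacent} if all edges between them are present. $X$ is \emph{prime} if each of its modules is $V(X)$ or a single vertex, and \emph{degenerate} if it is complete or edgeless. If $X$ is neither prime nor degenerate, its \emph{modular partition} $\mathcal P$ consists of the connected components of $X$ if $X$ is disconnected, of the connected components of the complement $\overline X$ if $\overline X$ is disconnected, and of the inclusion-maximal modules $M\neq V(X)$ if both $X$ and $\overline X$ are connected. The \emph{modular tree} $T$ of $X$ is a graph with two types of vertices (normal and marker vertices), two types of edges (normal undirected edges and directed tree edges), and a distinguished induced subgraph, its root node. It is defined recursively. If $X$ is prime or degenerate, then $T=X$ with all vertices and edges normal, and the root node is $T$. Otherwise let $\mathcal P=\{M_1,\dots,M_k\}$ be the modular partition and let $T_i$ be the modular tree of the induced subgraph $X[M_i]$. Then $T$ is the disjoint union of $T_1,\dots,T_k$ and of the quotient graph $X/\mathcal P$, on marker vertices $m_1,\dots,m_k$ where $m_im_j$ is a normal edge if and only if $i\ne j$ and $M_i$, $M_j$ are adjacent,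 together with, for each $i$, a new marker vertex $m_i'$ joined by normal edges to exactly the vertices of the root node of $T_i$, and a tree edge directed from $m_i$ to $m_i'$. The root node of $T$ is $X/\mathcal P$. Let $\mathrm{Aut}(T)$ be the group of permutations of the vertices of $T$ that preserve the types of vertices, the normal edges, and the tree edges with their orientation. \textbf{Lemma.} If $T$ is the modular tree of a finite graph $X$, then $\mathrm{Aut}(X)\cong\mathrm{Aut}(T)$. -/

import Mathlib

namespace ModularDecomposition

universe u

/-- A module of `X`: a nonempty set `M` of vertices such that every vertex outside `M` is adjacent
either to all vertices of `M` or to none of them. -/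
def IsModule {V : Type u} (X : SimpleGraph V) (M : Set V) : Prop :=
  M.Nonempty ∧ ∀ x, x ∉ M → (∀ y ∈ M, X.Adj x y) ∨ (∀ y ∈ M, ¬ X.Adj x y)

/-- A graph is prime if all its modules are trivial: the whole vertex set, or a single vertex. -/
def IsPrime {V : Type u} (X : SimpleGraph V) : Prop :=
  ∀ M : Set V, IsModule X M → M = Set.univ ∨ ∃ x, M = {x}

/-- A graph is degenerate if it is complete or edgeless. -/
def IsDegenerate {V : Type u} (X : SimpleGraph V) : Prop :=
  X = ⊤ ∨ X = ⊥

open Classical in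
/-- The partition used in the modular decomposition of a graph `X` that is neither prime nor
degenerate: the connected components of `X` if `X` is disconnected, the connected components of the
complement if that is disconnected, and otherwise the inclusion-maximal proper subsets of the
vertex set which are modules. -/
noncomputable def modularPartition {V : Type u} (X : SimpleGraph V) : Set (Set V) :=
  if ¬ X.Connected then {M | ∃ c : X.ConnectedComponent, M = c.supp}
  else if ¬ Xᶜ.Connected then {M | ∃ c : Xᶜ.ConnectedComponent, M = c.supp}
  else {M | Maximal (fun N : Set V => IsModule X N ∧ N ≠ Set.univ) M}

/-- The quotient graph: its vertices are the parts, and two distinct parts are joined if and only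
if all edges between them are present. -/
def quotientGraph {V : Type u} (X : SimpleGraph V) (P : Set (Set V)) : SimpleGraph P where
  Adj M N := M ≠ N ∧ ∀ x ∈ M.1, ∀ y ∈ N.1, X.Adj x y
  symm := ⟨fun _ _ h => ⟨h.1.symm, fun x hx y hy => (h.2 y hy x hx).symm⟩⟩
  loopless := ⟨fun _ h => h.1 rfl⟩

/-- A graph with two types of vertices (normal and marker vertices), two types of edges (normal
undirected edges and directed tree edges), and a distinguished set of vertices, which spans the
root node. -/
structure MarkedGraph where
  Vert : Type u
  graph : SimpleGraph Vert
  IsMarker : Vert → Prop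
  TreeEdge : Vert → Vert → Prop
  root : Set Vert

/-- The automorphism group of a marked graph: the permutations of the vertices that preserve the
types of vertices, the normal edges, and the tree edges with their orientation. -/
def MarkedGraph.Aut (T : MarkedGraph.{u}) : Subgroup (Equiv.Perm T.Vert) where
  carrier := {σ | (∀ v, T.IsMarker (σ v) ↔ T.IsMarker v) ∧
    (∀ v w, T.graph.Adj (σ v) (σ w) ↔ T.graph.Adj v w) ∧
    (∀ v w, T.TreeEdge (σ v) (σ w) ↔ T.TreeEdge v w)}
  one_mem' := ⟨fun _ => Iff.rfl, fun _ _ => Iff.rfl, fun _ _ => Iff.rfl⟩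
  mul_mem' := fun {σ τ} hσ hτ =>
    ⟨fun v => (hσ.1 (τ v)).trans (hτ.1 v),
     fun v w => (hσ.2.1 (τ v) (τ w)).trans (hτ.2.1 v w),
     fun v w => (hσ.2.2 (τ v) (τ w)).trans (hτ.2.2 v w)⟩
  inv_mem' := fun {σ} hσ =>
    ⟨fun v => by simpa using (hσ.1 (σ⁻¹ v)).symm,
     fun v w => by simpa using (hσ.2.1 (σ⁻¹ v) (σ⁻¹ w)).symm,
     fun v w => by simpa using (hσ.2.2 (σ⁻¹ v) (σ⁻¹ w)).symm⟩

/-- The graph `X` itself, as a marked graph without marker vertices and tree edges, all of which is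
the root node. -/
def leafTree {V : Type u} (X : SimpleGraph V) : MarkedGraph.{u} where
  Vert := V
  graph := X
  IsMarker _ := False
  TreeEdge _ _ := False
  root := Set.univ

/-- The vertices of the modular tree assembled from trees `T M`, one for each part `M`: the vertices
of all the `T M`, the marker vertex `quot M` of the quotient graph, and the additional marker vertex
`top M` which is attached to `T M`. -/
inductive GlueVert {V : Type u} (P : Set (Set V)) (T : P → MarkedGraph.{u}) : Type u
  | sub (M : P) (v : (T M).Vert) : GlueVert P T
  | quot (M : P) : GlueVert P T
  | top (M : P) : GlueVert P T

/-- The normal edges of the assembled tree: those of the trees `T M`, those of the quotient graph,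
and those joining `top M` to exactly the vertices of the root node of `T M`. -/
inductive GlueAdj {V : Type u} (X : SimpleGraph V) (P : Set (Set V)) (T : P → MarkedGraph.{u}) :
    GlueVert P T → GlueVert P T → Prop
  | sub (M : P) (v w : (T M).Vert) (h : (T M).graph.Adj v w) :
      GlueAdj X P T (.sub M v) (.sub M w)
  | quot (M N : P) (h : (quotientGraph X P).Adj M N) : GlueAdj X P T (.quot M) (.quot N)
  | top_root (M : P) (v : (T M).Vert) (h : v ∈ (T M).root) : GlueAdj X P T (.top M) (.sub M v)
  | root_top (M : P) (v : (T M).Vert) (h : v ∈ (T M).root) : GlueAdj X P T (.sub M v) (.top M)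

/-- The tree edges of the assembled tree: those of the trees `T M`, and one from `quot M` to
`top M` for every part `M`. -/
inductive GlueTreeEdge {V : Type u} (P : Set (Set V)) (T : P → MarkedGraph.{u}) :
    GlueVert P T → GlueVert P T → Prop
  | sub (M : P) (v w : (T M).Vert) (h : (T M).TreeEdge v w) :
      GlueTreeEdge P T (.sub M v) (.sub M w)
  | new (M : P) : GlueTreeEdge P T (.quot M) (.top M)

/-- The marker vertices of the assembled tree: those of the trees `T M`, and all the new
vertices. -/
def GlueMarker {V : Type u} (P : Set (Set V)) (T : P → MarkedGraph.{u}) : GlueVert P T → Prop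
  | .sub M v => (T M).IsMarker v
  | .quot _ => True
  | .top _ => True

/-- The tree assembled from the quotient graph, which is its root node, and the trees `T M`. -/
def glueTree {V : Type u} (X : SimpleGraph V) (P : Set (Set V)) (T : P → MarkedGraph.{u}) :
    MarkedGraph.{u} where
  Vert := GlueVert P T
  graph :=
    { Adj := GlueAdj X P T
      symm := ⟨fun _ _ h => by
        cases h with
        | sub M v w h => exact .sub M w v h.symm
        | quot M N h => exact .quot N M h.symm
        | top_root M v h => exact .root_top M v h
        | root_top M v h => exact .top_root M v h⟩
      loopless := ⟨fun _ h => by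
        cases h with
        | sub M v w h => exact (T M).graph.loopless.irrefl v h
        | quot M N h => exact (quotientGraph X P).loopless.irrefl M h⟩ }
  IsMarker := GlueMarker P T
  TreeEdge := GlueTreeEdge P T
  root := Set.range GlueVert.quot

theorem connected_of_supp_eq_univ {V : Type u} {X : SimpleGraph V} (c : X.ConnectedComponent)
    (h : c.supp = Set.univ) : X.Connected := by
  obtain ⟨v, hv⟩ := c.nonempty_supp
  have key : ∀ w, X.connectedComponentMk w = c := fun w => by
    have : w ∈ c.supp := h ▸ Set.mem_univ w
    exact this
  have : Nonempty V := ⟨v⟩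
  exact ⟨fun a b => SimpleGraph.ConnectedComponent.exact ((key a).trans (key b).symm)⟩

theorem ne_univ_of_mem_modularPartition {V : Type u} {X : SimpleGraph V} {M : Set V}
    (hM : M ∈ modularPartition X) : M ≠ Set.univ := by
  unfold modularPartition at hM
  split_ifs at hM with h1 h2
  · exact (show Maximal (fun N : Set V => IsModule X N ∧ N ≠ Set.univ) M from hM).prop.2
  · obtain ⟨c, rfl⟩ := hM
    exact fun h => h2 (connected_of_supp_eq_univ c h)
  · obtain ⟨c, rfl⟩ := hM
    exact fun h => h1 (connected_of_supp_eq_univ c h)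

theorem card_lt_of_mem_modularPartition {V : Type u} [Finite V] {X : SimpleGraph V} {M : Set V}
    (hM : M ∈ modularPartition X) : Nat.card M < Nat.card V := by
  rw [Nat.card_coe_set_eq, ← Set.ncard_univ]
  exact Set.ncard_lt_ncard (Set.ssubset_univ_iff.2 (ne_univ_of_mem_modularPartition hM))

open Classical in
/-- The modular tree of a finite graph `X`. If `X` is prime or degenerate it is `X` itself;
otherwise it is assembled from the quotient by the modular partition and the modular trees of the
subgraphs induced by the parts. -/
noncomputable def modularTree {V : Type u} [Finite V] (X : SimpleGraph V) : MarkedGraph.{u} :=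
  if IsPrime X ∨ IsDegenerate X then leafTree X
  else glueTree X (modularPartition X) (fun M => modularTree (X.induce M.1))
termination_by Nat.card V
decreasing_by exact card_lt_of_mem_modularPartition M.2

end ModularDecomposition

namespace ModularDecomposition

universe u

variable {V W : Type u}

/-! ### The modular partition -/

theorem IsModule.adj_iff {X : SimpleGraph V} {M : Set V} (hM : IsModule X M) {x y z : V}
    (hx : x ∉ M) (hy : y ∈ M) (hz : z ∈ M) : X.Adj x y ↔ X.Adj x z := by
  rcases hM.2 x hx with h | h
  · exact iff_of_true (h y hy) (h z hz)
  · exact iff_of_false (h y hy) (h z hz)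

theorem isModule_of_adj_iff {X : SimpleGraph V} {M : Set V} {c : V} (hc : c ∈ M)
    (h : ∀ x, x ∉ M → ∀ y ∈ M, (X.Adj x y ↔ X.Adj x c)) : IsModule X M := by
  refine ⟨⟨c, hc⟩, fun x hx => ?_⟩
  by_cases hxc : X.Adj x c
  · exact .inl fun y hy => (h x hx y hy).2 hxc
  · exact .inr fun y hy hxy => hxc ((h x hx y hy).1 hxy)

theorem isModule_singleton (X : SimpleGraph V) (x : V) : IsModule X {x} :=
  isModule_of_adj_iff rfl fun _ _ y hy => by rw [Set.mem_singleton_iff.1 hy]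

theorem IsModule.union {X : SimpleGraph V} {A B : Set V} (hA : IsModule X A) (hB : IsModule X B)
    {c : V} (hcA : c ∈ A) (hcB : c ∈ B) : IsModule X (A ∪ B) := by
  refine isModule_of_adj_iff (c := c) (.inl hcA) fun x hx y hy => ?_
  rcases hy with hy | hy
  · exact hA.adj_iff (fun h => hx (.inl h)) hy hcA
  · exact hB.adj_iff (fun h => hx (.inr h)) hy hcB

/-- A connected graph has an edge between any proper nonempty set of vertices and its
complement. -/
theorem exists_adj_of_connected {X : SimpleGraph V} (hX : X.Connected) {B : Set V} {a b : V}
    (ha : a ∉ B) (hb : b ∈ B) : ∃ v w, v ∉ B ∧ w ∈ B ∧ X.Adj v w := by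
  by_contra! h
  have key : ∀ v, X.Reachable a v → v ∉ B := by
    intro v hv
    rw [SimpleGraph.reachable_iff_reflTransGen] at hv
    induction hv with
    | refl => exact ha
    | tail _ hvw ih => exact fun hw => h _ _ ih hw hvw
  exact key b (hX.preconnected a b) hb

/-- If two overlapping modules, neither containing the other, cover the vertex set, then the graph
or its complement is disconnected. -/
theorem not_connected_of_union_eq_univ {X : SimpleGraph V} {A B : Set V} (hA : IsModule X A)
    (hB : IsModule X B) {a b c : V} (haB : a ∉ B) (hbA : b ∉ A) (hcA : c ∈ A) (hcB : c ∈ B)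
    (hU : A ∪ B = Set.univ) (hX : X.Connected) (hX' : Xᶜ.Connected) : False := by
  have memA : ∀ {v}, v ∉ B → v ∈ A := fun {v} hv =>
    (hU ▸ Set.mem_univ v : v ∈ A ∪ B).resolve_right hv
  have memB : ∀ {v}, v ∉ A → v ∈ B := fun {v} hv =>
    (hU ▸ Set.mem_univ v : v ∈ A ∪ B).resolve_left hv
  have key : ∀ v w, v ∉ B → w ∈ B → (X.Adj v w ↔ X.Adj b c) := by
    intro v w hv hw
    rw [hB.adj_iff hv hw (memB hbA), X.adj_comm, hA.adj_iff hbA (memA hv) hcA]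
  obtain ⟨v, w, hv, hw, hvw⟩ := exists_adj_of_connected hX haB hcB
  obtain ⟨v', w', hv', hw', hvw'⟩ := exists_adj_of_connected hX' haB hcB
  rw [SimpleGraph.compl_adj] at hvw'
  exact hvw'.2 ((key v' w' hv' hw').2 ((key v w hv hw).1 hvw))

/-- A partition of the vertex set such that adjacency of vertices from different parts depends only
on the parts. -/
structure IsCongruence (X : SimpleGraph V) (P : Set (Set V)) : Prop where
  nonempty : ∀ M ∈ P, M.Nonempty
  cover : ∀ x, ∃ M ∈ P, x ∈ M
  disjoint : ∀ M ∈ P, ∀ N ∈ P, ∀ x ∈ M, x ∈ N → M = N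
  uniform : ∀ M ∈ P, ∀ N ∈ P, M ≠ N → ∀ x ∈ M, ∀ x' ∈ M, ∀ y ∈ N, ∀ y' ∈ N,
    X.Adj x y → X.Adj x' y'

theorem IsCongruence.quotientGraph_adj {X : SimpleGraph V} {P : Set (Set V)}
    (hP : IsCongruence X P) {M N : P} (h : M ≠ N) {x y : V} (hx : x ∈ M.1) (hy : y ∈ N.1) :
    (quotientGraph X P).Adj M N ↔ X.Adj x y :=
  ⟨fun hMN => hMN.2 x hx y hy, fun hxy => ⟨h, fun x' hx' y' hy' =>
    hP.uniform M M.2 N N.2 (fun h' => h (Subtype.ext h')) x hx x' hx' y hy y' hy' hxy⟩⟩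

theorem not_adj_of_mem_supp {X : SimpleGraph V} {c d : X.ConnectedComponent} (h : c.supp ≠ d.supp)
    {x y : V} (hx : x ∈ c.supp) (hy : y ∈ d.supp) : ¬ X.Adj x y := fun hxy => h <| by
  rw [SimpleGraph.ConnectedComponent.mem_supp_iff] at hx hy
  rw [← hx, ← hy, SimpleGraph.ConnectedComponent.sound hxy.reachable]

theorem isCongruence_supp (X Y : SimpleGraph V)
    (h : ∀ c d : Y.ConnectedComponent, c.supp ≠ d.supp → ∀ x ∈ c.supp, ∀ x' ∈ c.supp,
      ∀ y ∈ d.supp, ∀ y' ∈ d.supp, X.Adj x y → X.Adj x' y') :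
    IsCongruence X {M | ∃ c : Y.ConnectedComponent, M = c.supp} where
  nonempty := by
    rintro _ ⟨c, rfl⟩
    exact c.nonempty_supp
  cover x := ⟨_, ⟨Y.connectedComponentMk x, rfl⟩, rfl⟩
  disjoint := by
    rintro _ ⟨c, rfl⟩ _ ⟨d, rfl⟩ x hx hy
    rw [SimpleGraph.ConnectedComponent.mem_supp_iff] at hx hy
    rw [← hx, ← hy]
  uniform := by
    rintro _ ⟨c, rfl⟩ _ ⟨d, rfl⟩
    exact h c d

theorem isCongruence_maximal [Finite V] [Nontrivial V] {X : SimpleGraph V} (hX : X.Connected)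
    (hX' : Xᶜ.Connected) :
    IsCongruence X {M | Maximal (fun N : Set V => IsModule X N ∧ N ≠ Set.univ) M} := by
  have disj : ∀ M N : Set V, Maximal (fun N : Set V => IsModule X N ∧ N ≠ Set.univ) M →
      Maximal (fun N : Set V => IsModule X N ∧ N ≠ Set.univ) N → ∀ x ∈ M, x ∈ N → M = N := by
    intro M N hM hN x hxM hxN
    by_contra hne
    have h1 : ¬ M ⊆ N := fun h => hne (h.antisymm (hM.2 hN.1 h))
    have h2 : ¬ N ⊆ M := fun h => hne ((hN.2 hM.1 h).antisymm h)
    obtain ⟨a, -, ha⟩ := Set.not_subset.1 h1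
    obtain ⟨b, hbN, hb⟩ := Set.not_subset.1 h2
    by_cases hU : M ∪ N = Set.univ
    · exact not_connected_of_union_eq_univ hM.1.1 hN.1.1 ha hb hxM hxN hU hX hX'
    · exact hb (hM.2 ⟨hM.1.1.union hN.1.1 hxM hxN, hU⟩ Set.subset_union_left (.inr hbN))
  refine ⟨fun M hM => hM.1.1.1, fun x => ?_, fun M hM N hN => disj M N hM hN, ?_⟩
  · have hx : IsModule X {x} ∧ ({x} : Set V) ≠ Set.univ :=
      ⟨isModule_singleton X x, Set.singleton_ne_univ x⟩
    obtain ⟨M, hxM, hM⟩ := Set.Finite.exists_le_maximal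
      (s := {N : Set V | IsModule X N ∧ N ≠ Set.univ}) (Set.toFinite _) hx
    exact ⟨M, hM, hxM rfl⟩
  · intro M hM N hN hne x hx x' hx' y hy y' hy' hxy
    have hxN : x ∉ N := fun h => hne (disj M N hM hN x hx h)
    have hyM : y' ∉ M := fun h => hne (disj M N hM hN y' h hy')
    exact ((hM.1.1.adj_iff hyM hx hx').1 ((hN.1.1.adj_iff hxN hy hy').1 hxy).symm).symm

theorem isCongruence_modularPartition [Finite V] {X : SimpleGraph V}
    (h : ¬ (IsPrime X ∨ IsDegenerate X)) : IsCongruence X (modularPartition X) := by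
  have : Nontrivial V := by
    rw [← not_subsingleton_iff_nontrivial]
    exact fun _ => h (.inr (.inr (Subsingleton.elim _ _)))
  unfold modularPartition
  split_ifs with h1 h2
  · exact isCongruence_maximal h1 h2
  · refine isCongruence_supp X Xᶜ fun c d hcd x _ x' hx' y _ y' hy' _ => ?_
    have := not_adj_of_mem_supp hcd hx' hy'
    rw [SimpleGraph.compl_adj, not_and_not_right] at this
    refine this fun he => hcd ?_
    subst he
    rw [SimpleGraph.ConnectedComponent.mem_supp_iff] at hx' hy'
    rw [← hx', ← hy']
  · exact isCongruence_supp X X fun c d hcd x hx x' _ y hy y' _ hxy =>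
      (not_adj_of_mem_supp hcd hx hy hxy).elim

/-! ### Invariance under isomorphisms -/

theorem IsModule.image {X : SimpleGraph V} {Y : SimpleGraph W} (f : X ≃g Y) {M : Set V}
    (hM : IsModule X M) : IsModule Y (f '' M) := by
  obtain ⟨⟨c, hc⟩, -⟩ := id hM
  refine isModule_of_adj_iff (Set.mem_image_of_mem f hc) ?_
  intro x hx y hy
  obtain ⟨x, rfl⟩ := f.surjective x
  obtain ⟨y, hy, rfl⟩ := hy
  rw [f.map_adj_iff, f.map_adj_iff]
  exact hM.adj_iff (fun h => hx (Set.mem_image_of_mem f h)) hy hc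

theorem image_symm_image {X : SimpleGraph V} {Y : SimpleGraph W} (f : X ≃g Y) (M : Set W) :
    f '' (f.symm '' M) = M := by
  rw [← Set.image_comp]
  simp

theorem image_eq_univ_iff {X : SimpleGraph V} {Y : SimpleGraph W} (f : X ≃g Y) (M : Set V) :
    f '' M = Set.univ ↔ M = Set.univ := by
  rw [← Set.image_univ_of_surjective f.surjective, f.injective.image_injective.eq_iff]

theorem IsPrime.of_iso {X : SimpleGraph V} {Y : SimpleGraph W} (f : X ≃g Y) (h : IsPrime X) :
    IsPrime Y := by
  intro M hM
  rcases h _ (hM.image f.symm) with h | ⟨x, h⟩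
  · exact .inl ((image_eq_univ_iff f.symm M).1 h)
  · exact .inr ⟨f x, by rw [← image_symm_image f M, h, Set.image_singleton]⟩

theorem IsDegenerate.of_iso {X : SimpleGraph V} {Y : SimpleGraph W} (f : X ≃g Y)
    (h : IsDegenerate X) : IsDegenerate Y := by
  refine h.imp ?_ ?_
  · rintro rfl
    ext a b
    rw [← f.symm.map_adj_iff]
    simp
  · rintro rfl
    ext a b
    rw [← f.symm.map_adj_iff]
    simp

/-- An isomorphism of graphs, as an isomorphism of their complements. -/
def complIso {X : SimpleGraph V} {Y : SimpleGraph W} (f : X ≃g Y) : Xᶜ ≃g Yᶜ where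
  toEquiv := f.toEquiv
  map_rel_iff' {a b} := by
    simp [SimpleGraph.compl_adj, f.map_adj_iff]

theorem image_supp {X : SimpleGraph V} {Y : SimpleGraph W} (f : X ≃g Y)
    (c : X.ConnectedComponent) : ∃ d : Y.ConnectedComponent, f '' c.supp = d.supp := by
  induction c using SimpleGraph.ConnectedComponent.ind with | h v =>
  refine ⟨Y.connectedComponentMk (f v), ?_⟩
  ext w
  obtain ⟨w, rfl⟩ := f.surjective w
  rw [f.injective.mem_set_image, SimpleGraph.ConnectedComponent.mem_supp_iff,
    SimpleGraph.ConnectedComponent.mem_supp_iff, SimpleGraph.ConnectedComponent.eq,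
    SimpleGraph.ConnectedComponent.eq, f.reachable_iff]

theorem image_mem_modularPartition {X : SimpleGraph V} {Y : SimpleGraph W} (f : X ≃g Y)
    {M : Set V} (hM : M ∈ modularPartition X) : f '' M ∈ modularPartition Y := by
  unfold modularPartition at hM ⊢
  rw [f.connected_iff, (complIso f).connected_iff] at hM
  split_ifs at hM ⊢ with h1 h2
  · obtain ⟨⟨h, hU⟩, hmax⟩ :=
      (show Maximal (fun N : Set V => IsModule X N ∧ N ≠ Set.univ) M from hM)
    refine ⟨⟨h.image f, fun h => hU ((image_eq_univ_iff f M).1 h)⟩, fun N hN hMN => ?_⟩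
    have := hmax (y := f.symm '' N)
      ⟨hN.1.image f.symm, fun h => hN.2 ((image_eq_univ_iff f.symm N).1 h)⟩ (by
        intro x hx
        exact ⟨f x, hMN (Set.mem_image_of_mem f hx), f.symm_apply_apply x⟩)
    rw [← image_symm_image f N]
    exact Set.image_mono this
  · obtain ⟨c, rfl⟩ := hM
    exact image_supp (complIso f) c
  · obtain ⟨c, rfl⟩ := hM
    exact image_supp f c

/-- The bijection between the modular partitions induced by an isomorphism of graphs. -/
noncomputable def partMap {X : SimpleGraph V} {Y : SimpleGraph W} (f : X ≃g Y) :
    modularPartition X ≃ modularPartition Y :=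
  Equiv.ofBijective (fun M => ⟨f '' M.1, image_mem_modularPartition f M.2⟩)
    ⟨fun _ _ h => Subtype.ext (f.injective.image_injective (congrArg Subtype.val h)),
      fun M => ⟨⟨f.symm '' M.1, image_mem_modularPartition f.symm M.2⟩,
        Subtype.ext (image_symm_image f M.1)⟩⟩

theorem partMap_val {X : SimpleGraph V} {Y : SimpleGraph W} (f : X ≃g Y)
    (M : modularPartition X) : (partMap f M).1 = f '' M.1 := rfl

/-- The restriction of an isomorphism of graphs to a part of the modular partition. -/
noncomputable def partIso {X : SimpleGraph V} {Y : SimpleGraph W} (f : X ≃g Y)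
    (M : modularPartition X) : X.induce M.1 ≃g Y.induce (partMap f M).1 where
  toEquiv := f.toEquiv.image M.1
  map_rel_iff' {_ _} := f.map_adj_iff

theorem partIso_val {X : SimpleGraph V} {Y : SimpleGraph W} (f : X ≃g Y)
    (M : modularPartition X) (x : M.1) : (partIso f M x : W) = f x := rfl

theorem quotientGraph_adj_partMap {X : SimpleGraph V} {Y : SimpleGraph W} (f : X ≃g Y)
    (M N : modularPartition X) :
    (quotientGraph Y (modularPartition Y)).Adj (partMap f M) (partMap f N) ↔
      (quotientGraph X (modularPartition X)).Adj M N := by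
  refine and_congr (partMap f).injective.ne_iff ?_
  simp only [partMap_val, Set.forall_mem_image, f.map_adj_iff]

/-! ### Isomorphisms of marked graphs -/

/-- Isomorphisms of marked graphs: the bijections that preserve the types of vertices, the normal
edges, and the tree edges with their orientation. -/
structure MarkedGraph.Iso (T S : MarkedGraph.{u}) extends T.Vert ≃ S.Vert where
  marker : ∀ v, S.IsMarker (toFun v) ↔ T.IsMarker v
  adj : ∀ v w, S.graph.Adj (toFun v) (toFun w) ↔ T.graph.Adj v w
  treeEdge : ∀ v w, S.TreeEdge (toFun v) (toFun w) ↔ T.TreeEdge v w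

namespace MarkedGraph.Iso

variable {T S : MarkedGraph.{u}}

/-- The inverse of an isomorphism of marked graphs. -/
def symm (F : T.Iso S) : S.Iso T where
  toEquiv := F.toEquiv.symm
  marker v := by simpa using (F.marker (F.toEquiv.symm v)).symm
  adj v w := by simpa using (F.adj (F.toEquiv.symm v) (F.toEquiv.symm w)).symm
  treeEdge v w := by simpa using (F.treeEdge (F.toEquiv.symm v) (F.toEquiv.symm w)).symm

theorem symm_apply_eq (F : T.Iso S) {v : T.Vert} {w : S.Vert} (h : F.toEquiv v = w) :
    F.symm.toEquiv w = v := by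
  rw [← h]
  exact F.toEquiv.symm_apply_apply v

end MarkedGraph.Iso

/-- A vertex with an incoming tree edge. -/
def MarkedGraph.IsTop (T : MarkedGraph.{u}) (v : T.Vert) : Prop := ∃ w, T.TreeEdge w v

/-- A vertex which has no incoming tree edge and is not adjacent to a vertex which has one. -/
def MarkedGraph.IsRootVertex (T : MarkedGraph.{u}) (v : T.Vert) : Prop :=
  ¬ T.IsTop v ∧ ∀ w, T.graph.Adj v w → ¬ T.IsTop w

/-- Two vertices joined by a normal edge or a tree edge. -/
def MarkedGraph.Link (T : MarkedGraph.{u}) (v w : T.Vert) : Prop :=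
  T.graph.Adj v w ∨ T.TreeEdge v w ∨ T.TreeEdge w v

namespace MarkedGraph.Iso

variable {T S : MarkedGraph.{u}}

theorem marker_iff (F : T.Iso S) {v : T.Vert} {v' : S.Vert} (hv : F.toEquiv v = v') :
    S.IsMarker v' ↔ T.IsMarker v := hv ▸ F.marker v

theorem adj_iff (F : T.Iso S) {v w : T.Vert} {v' w' : S.Vert} (hv : F.toEquiv v = v')
    (hw : F.toEquiv w = w') : S.graph.Adj v' w' ↔ T.graph.Adj v w := hv ▸ hw ▸ F.adj v w

theorem treeEdge_iff (F : T.Iso S) {v w : T.Vert} {v' w' : S.Vert} (hv : F.toEquiv v = v')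
    (hw : F.toEquiv w = w') : S.TreeEdge v' w' ↔ T.TreeEdge v w := hv ▸ hw ▸ F.treeEdge v w

theorem isTop (F : T.Iso S) (v : T.Vert) : S.IsTop (F.toEquiv v) ↔ T.IsTop v := by
  constructor
  · rintro ⟨w, hw⟩
    obtain ⟨w, rfl⟩ := F.toEquiv.surjective w
    exact ⟨w, (F.treeEdge w v).1 hw⟩
  · rintro ⟨w, hw⟩
    exact ⟨F.toEquiv w, (F.treeEdge w v).2 hw⟩

theorem isRootVertex (F : T.Iso S) (v : T.Vert) :
    S.IsRootVertex (F.toEquiv v) ↔ T.IsRootVertex v := by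
  refine and_congr (not_congr (F.isTop v)) ?_
  rw [← F.toEquiv.forall_congr_right]
  exact forall_congr' fun w => imp_congr (F.adj v w) (not_congr (F.isTop w))

theorem link (F : T.Iso S) {v w : T.Vert} (h : T.Link v w) :
    S.Link (F.toEquiv v) (F.toEquiv w) :=
  h.imp (F.adj v w).2 (Or.imp (F.treeEdge v w).2 (F.treeEdge w v).2)

end MarkedGraph.Iso

/-! ### Adjacency in assembled trees -/

section glue

variable {X : SimpleGraph V} {P : Set (Set V)} {T : P → MarkedGraph.{u}}

theorem glue_adj_sub_sub {M : P} {v w : (T M).Vert} :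
    (glueTree X P T).graph.Adj (.sub M v) (.sub M w) ↔ (T M).graph.Adj v w :=
  ⟨fun h => by cases h; assumption, GlueAdj.sub M v w⟩

theorem eq_of_glueAdj_sub_sub {M N : P} {v : (T M).Vert} {w : (T N).Vert}
    (h : GlueAdj X P T (.sub M v) (.sub N w)) : M = N := by
  cases h; rfl

theorem eq_of_glueAdj_top_sub {M N : P} {w : (T N).Vert}
    (h : GlueAdj X P T (.top M) (.sub N w)) : M = N := by
  cases h; rfl

theorem glue_adj_quot_quot {M N : P} :
    (glueTree X P T).graph.Adj (.quot M) (.quot N) ↔ (quotientGraph X P).Adj M N :=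
  ⟨fun h => by cases h; assumption, GlueAdj.quot M N⟩

theorem glue_adj_top_sub {M : P} {v : (T M).Vert} :
    (glueTree X P T).graph.Adj (.top M) (.sub M v) ↔ v ∈ (T M).root :=
  ⟨fun h => by cases h; assumption, GlueAdj.top_root M v⟩

theorem glue_treeEdge_sub_sub {M : P} {v w : (T M).Vert} :
    (glueTree X P T).TreeEdge (.sub M v) (.sub M w) ↔ (T M).TreeEdge v w :=
  ⟨fun h => by cases h; assumption, GlueTreeEdge.sub M v w⟩

theorem eq_of_glueTreeEdge_sub_sub {M N : P} {v : (T M).Vert} {w : (T N).Vert}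
    (h : GlueTreeEdge P T (.sub M v) (.sub N w)) : M = N := by
  cases h; rfl

theorem glue_isTop_sub {M : P} {v : (T M).Vert} :
    (glueTree X P T).IsTop (.sub M v) ↔ (T M).IsTop v := by
  constructor
  · rintro ⟨w, hw⟩
    cases hw with | sub M u v h => exact ⟨u, h⟩
  · rintro ⟨w, hw⟩
    exact ⟨_, GlueTreeEdge.sub M w v hw⟩

theorem glue_isTop_top (M : P) : (glueTree X P T).IsTop (.top M) := ⟨_, .new M⟩

theorem glue_not_isTop_quot (M : P) : ¬ (glueTree X P T).IsTop (.quot M) := by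
  rintro ⟨w, hw⟩
  cases hw

theorem glue_treeEdge_quot {M : P} {v : (glueTree X P T).Vert} :
    (glueTree X P T).TreeEdge (.quot M) v ↔ v = .top M :=
  ⟨fun h => by cases h; rfl, fun h => h ▸ .new M⟩

theorem glue_isRootVertex_iff (hroot : ∀ M v, v ∈ (T M).root ↔ (T M).IsRootVertex v)
    (v : (glueTree X P T).Vert) :
    v ∈ (glueTree X P T).root ↔ (glueTree X P T).IsRootVertex v := by
  constructor
  · rintro ⟨M, rfl⟩
    refine ⟨glue_not_isTop_quot M, fun w hw => ?_⟩
    cases hw with | quot M N h => exact glue_not_isTop_quot N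
  · rintro ⟨h1, h2⟩
    cases v with
    | quot M => exact ⟨M, rfl⟩
    | top M => exact (h1 (glue_isTop_top M)).elim
    | sub M v =>
      refine (h2 (.top M) (GlueAdj.root_top M v ?_) (glue_isTop_top M)).elim
      rw [hroot]
      exact ⟨fun h => h1 (glue_isTop_sub.2 h), fun w hw h =>
        h2 (.sub M w) (GlueAdj.sub M v w hw) (glue_isTop_sub.2 h)⟩

theorem glue_link_sub {M : P} {v w : (T M).Vert} (h : (T M).Link v w) :
    (glueTree X P T).Link (.sub M v) (.sub M w) :=
  h.imp (GlueAdj.sub M v w) (Or.imp (GlueTreeEdge.sub M v w) (GlueTreeEdge.sub M w v))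

theorem glue_link_sub_right {N : P} {v : (glueTree X P T).Vert} {w : (T N).Vert}
    (h : (glueTree X P T).Link v (.sub N w)) : (∃ u, v = .sub N u) ∨ v = .top N := by
  rcases h with h | h | h
  · cases h with
    | sub M v w h => exact .inl ⟨_, rfl⟩
    | top_root M v h => exact .inr rfl
  · cases h with | sub M v w h => exact .inl ⟨_, rfl⟩
  · cases h with | sub M v w h => exact .inl ⟨_, rfl⟩

theorem glue_exists_link_root
    (h : ∀ M v, ∃ r ∈ (T M).root, Relation.ReflTransGen (T M).Link v r)
    (v : (glueTree X P T).Vert) :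
    ∃ r ∈ (glueTree X P T).root, Relation.ReflTransGen (glueTree X P T).Link v r := by
  cases v with
  | quot M => exact ⟨_, ⟨M, rfl⟩, .refl⟩
  | top M => exact ⟨_, ⟨M, rfl⟩, .single (.inr (.inr (.new M)))⟩
  | sub M v =>
    obtain ⟨r, hr, hvr⟩ := h M v
    refine ⟨_, ⟨M, rfl⟩, .tail (.tail (hvr.lift (GlueVert.sub M) fun _ _ => glue_link_sub)
      (.inl (GlueAdj.root_top M r hr))) (.inr (.inr (.new M)))⟩

end glue

/-! ### Modular trees with their leaves -/

/-- `IsModularTree X T ι` says that `T` is the modular tree of `X`, and that `ι` sends each vertex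
of `X` to the corresponding normal vertex of `T`. -/
inductive IsModularTree :
    {V : Type u} → SimpleGraph V → (T : MarkedGraph.{u}) → (V → T.Vert) → Prop
  | leaf {V : Type u} (X : SimpleGraph V) (h : IsPrime X ∨ IsDegenerate X) :
      IsModularTree X (leafTree X) id
  | glue {V : Type u} (X : SimpleGraph V) (h : ¬ (IsPrime X ∨ IsDegenerate X))
      (hP : IsCongruence X (modularPartition X)) (T : modularPartition X → MarkedGraph.{u})
      (ι : ∀ M : modularPartition X, M.1 → (T M).Vert)
      (hT : ∀ M : modularPartition X, IsModularTree (X.induce M.1) (T M) (ι M))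
      (κ : V → (glueTree X (modularPartition X) T).Vert)
      (hκ : ∀ (M : modularPartition X) (x : M.1), κ x = .sub M (ι M x)) :
      IsModularTree X (glueTree X (modularPartition X) T) κ

theorem exists_isModularTree [Finite V] (X : SimpleGraph V) :
    ∃ ι, IsModularTree X (modularTree X) ι := by
  induction hn : Nat.card V using Nat.strong_induction_on generalizing V with
  | _ n ih =>
  by_cases h : IsPrime X ∨ IsDegenerate X
  · rw [modularTree, if_pos h]
    exact ⟨_, .leaf X h⟩
  · rw [modularTree, if_neg h]
    have hP := isCongruence_modularPartition h
    have : ∀ M : modularPartition X, ∃ ι,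
        IsModularTree (X.induce M.1) (modularTree (X.induce M.1)) ι :=
      fun M => ih _ (hn ▸ card_lt_of_mem_modularPartition M.2) _ rfl
    choose ι hι using this
    choose part hpart hmem using hP.cover
    refine ⟨_, .glue X h hP _ ι hι
      (fun x => .sub ⟨part x, hpart x⟩ (ι ⟨part x, hpart x⟩ ⟨x, hmem x⟩)) ?_⟩
    rintro ⟨M, hM⟩ ⟨x, hx⟩
    obtain rfl : part x = M := hP.disjoint _ (hpart x) _ hM x (hmem x) hx
    rfl

namespace IsModularTree

theorem mem_root_iff {X : SimpleGraph V} {T : MarkedGraph.{u}} {ι : V → T.Vert}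
    (h : IsModularTree X T ι) (v : T.Vert) : v ∈ T.root ↔ T.IsRootVertex v := by
  induction h with
  | leaf X h =>
    have : ∀ v, ¬ (leafTree X).IsTop v := fun v hv => hv.choose_spec
    exact iff_of_true (Set.mem_univ v) ⟨this v, fun w _ => this w⟩
  | glue X h hP T ι hT κ hκ ih => exact glue_isRootVertex_iff ih v

theorem exists_link_root {X : SimpleGraph V} {T : MarkedGraph.{u}} {ι : V → T.Vert}
    (h : IsModularTree X T ι) (v : T.Vert) :
    ∃ r ∈ T.root, Relation.ReflTransGen T.Link v r := by
  induction h with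
  | leaf X h => exact ⟨v, Set.mem_univ v, .refl⟩
  | glue X h hP T ι hT κ hκ ih => exact glue_exists_link_root ih v

theorem injective {X : SimpleGraph V} {T : MarkedGraph.{u}} {ι : V → T.Vert}
    (h : IsModularTree X T ι) : Function.Injective ι := by
  induction h with
  | leaf X h => exact Function.injective_id
  | glue X h hP T ι hT κ hκ ih =>
    intro x y hxy
    obtain ⟨M, hM, hx⟩ := hP.cover x
    obtain ⟨N, hN, hy⟩ := hP.cover y
    rw [hκ ⟨M, hM⟩ ⟨x, hx⟩, hκ ⟨N, hN⟩ ⟨y, hy⟩] at hxy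
    injection hxy with h1 h2
    obtain rfl : M = N := congrArg Subtype.val h1
    exact congrArg Subtype.val (ih _ (eq_of_heq h2))

theorem exists_apply_eq_iff {X : SimpleGraph V} {T : MarkedGraph.{u}} {ι : V → T.Vert}
    (h : IsModularTree X T ι) (t : T.Vert) : (∃ x, ι x = t) ↔ ¬ T.IsMarker t := by
  induction h with
  | leaf X h => exact iff_of_true ⟨t, rfl⟩ not_false
  | glue X h hP T ι hT κ hκ ih =>
    constructor
    · rintro ⟨x, rfl⟩
      obtain ⟨M, hM, hx⟩ := hP.cover x
      rw [hκ ⟨M, hM⟩ ⟨x, hx⟩]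
      exact (ih ⟨M, hM⟩ _).1 ⟨_, rfl⟩
    · intro ht
      cases t with
      | quot M => exact (ht trivial).elim
      | top M => exact (ht trivial).elim
      | sub M t =>
        obtain ⟨x, rfl⟩ := (ih M t).2 ht
        exact ⟨x, hκ M x⟩

end IsModularTree

/-! ### Isomorphisms of assembled trees -/

section glueIso

variable {X : SimpleGraph V} {P : Set (Set V)} {T : P → MarkedGraph.{u}}
  {Y : SimpleGraph W} {Q : Set (Set W)} {S : Q → MarkedGraph.{u}}

theorem glueIso_quot (hT : ∀ M v, v ∈ (T M).root ↔ (T M).IsRootVertex v)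
    (hS : ∀ N v, v ∈ (S N).root ↔ (S N).IsRootVertex v)
    (F : (glueTree X P T).Iso (glueTree Y Q S)) (M : P) :
    ∃ N : Q, F.toEquiv (.quot M) = .quot N := by
  obtain ⟨N, hN⟩ := (glue_isRootVertex_iff hS _).2
    ((F.isRootVertex _).2 ((glue_isRootVertex_iff hT _).1 ⟨M, rfl⟩))
  exact ⟨N, hN.symm⟩

theorem glueIso_top (F : (glueTree X P T).Iso (glueTree Y Q S)) {M : P} {N : Q}
    (h : F.toEquiv (.quot M) = .quot N) : F.toEquiv (.top M) = .top N :=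
  glue_treeEdge_quot.1 ((F.treeEdge_iff h rfl).2 (.new M))

theorem glueIso_sub (hT : ∀ M v, ∃ r ∈ (T M).root, Relation.ReflTransGen (T M).Link v r)
    (F : (glueTree X P T).Iso (glueTree Y Q S)) {M : P} {N : Q}
    (h : F.toEquiv (.quot M) = .quot N) (v : (T M).Vert) :
    ∃ w, F.toEquiv (.sub M v) = .sub N w := by
  have htop := glueIso_top F h
  have hne : ∀ v, F.toEquiv (.sub M v) ≠ .top N := fun v hv => by
    cases F.toEquiv.injective (hv.trans htop.symm)
  obtain ⟨r, hr, hvr⟩ := hT M v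
  induction hvr using Relation.ReflTransGen.head_induction_on with
  | refl =>
    have := (F.adj_iff htop rfl).2 (GlueAdj.top_root M r hr)
    generalize F.toEquiv (.sub M r) = z at this
    cases this with | top_root N w h => exact ⟨w, rfl⟩
  | head hab _ ih =>
    obtain ⟨w, hw⟩ := ih
    have := F.link (glue_link_sub (X := X) (P := P) (T := T) hab)
    rw [hw] at this
    exact (glue_link_sub_right this).resolve_right (hne _)

/-- An isomorphism of assembled trees restricts to the trees from which they are assembled. -/
theorem glueIso_restrict (hT : ∀ M v, ∃ r ∈ (T M).root, Relation.ReflTransGen (T M).Link v r)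
    (hS : ∀ N v, ∃ r ∈ (S N).root, Relation.ReflTransGen (S N).Link v r)
    (F : (glueTree X P T).Iso (glueTree Y Q S)) {M : P} {N : Q}
    (h : F.toEquiv (.quot M) = .quot N) :
    ∃ G : (T M).Iso (S N), ∀ v, F.toEquiv (.sub M v) = .sub N (G.toEquiv v) := by
  choose g hg using glueIso_sub hT F h
  have hbij : Function.Bijective g := by
    constructor
    · intro v w hvw
      have := F.toEquiv.injective ((hg v).trans ((congrArg _ hvw).trans (hg w).symm))
      injection this with _ h2
    · intro w
      obtain ⟨v, hv⟩ := glueIso_sub hS F.symm (F.symm_apply_eq h) w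
      have h1 : F.toEquiv (.sub M v) = .sub N w := F.symm.symm_apply_eq hv
      rw [hg] at h1
      injection h1 with _ h2
      exact ⟨v, h2⟩
  refine ⟨⟨Equiv.ofBijective g hbij, fun v => ?_, fun v w => ?_, fun v w => ?_⟩, hg⟩
  · exact F.marker_iff (hg v)
  · exact glue_adj_sub_sub.symm.trans ((F.adj_iff (hg v) (hg w)).trans glue_adj_sub_sub)
  · exact glue_treeEdge_sub_sub.symm.trans
      ((F.treeEdge_iff (hg v) (hg w)).trans glue_treeEdge_sub_sub)

/-- The map of assembled trees given by a map of the parts and maps of the trees from which they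
are assembled. -/
def glueMap (π : P → Q) (g : ∀ M, (T M).Vert → (S (π M)).Vert) : GlueVert P T → GlueVert Q S
  | .sub M v => .sub (π M) (g M v)
  | .quot M => .quot (π M)
  | .top M => .top (π M)

theorem glueMap_bijective (π : P ≃ Q) (g : ∀ M, (T M).Vert ≃ (S (π M)).Vert) :
    Function.Bijective (glueMap (T := T) (S := S) π fun M => g M) := by
  constructor
  · intro v w h
    cases v <;> cases w <;> simp only [glueMap, reduceCtorEq] at h
    · injection h with h1 h2
      obtain rfl := π.injective h1
      rw [(g _).injective (eq_of_heq h2)]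
    · injection h with h1
      rw [π.injective h1]
    · injection h with h1
      rw [π.injective h1]
  · intro w
    cases w with
    | sub N w =>
      obtain ⟨M, rfl⟩ := π.surjective N
      obtain ⟨v, rfl⟩ := (g M).surjective w
      exact ⟨.sub M v, rfl⟩
    | quot N =>
      obtain ⟨M, rfl⟩ := π.surjective N
      exact ⟨.quot M, rfl⟩
    | top N =>
      obtain ⟨M, rfl⟩ := π.surjective N
      exact ⟨.top M, rfl⟩

/-- Isomorphisms of the quotient graphs and of the trees for the parts assemble to an isomorphism
of the assembled trees. -/
noncomputable def glueIso (hT : ∀ M v, v ∈ (T M).root ↔ (T M).IsRootVertex v)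
    (hS : ∀ N v, v ∈ (S N).root ↔ (S N).IsRootVertex v) (π : P ≃ Q)
    (hπ : ∀ M N, (quotientGraph Y Q).Adj (π M) (π N) ↔ (quotientGraph X P).Adj M N)
    (G : ∀ M, (T M).Iso (S (π M))) : (glueTree X P T).Iso (glueTree Y Q S) where
  toEquiv := Equiv.ofBijective (glueMap π fun M => (G M).toEquiv)
    (glueMap_bijective π fun M => (G M).toEquiv)
  marker v := by
    cases v with
    | sub M v => exact (G M).marker v
    | quot M => exact Iff.rfl
    | top M => exact Iff.rfl
  adj v w := by
    have hroot : ∀ M v, (G M).toEquiv v ∈ (S (π M)).root ↔ v ∈ (T M).root := fun M v => by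
      rw [hS, hT, (G M).isRootVertex]
    change GlueAdj Y Q S (glueMap π _ v) (glueMap π _ w) ↔ GlueAdj X P T v w
    constructor
    · intro h
      rcases v with ⟨M, v⟩ | M | M <;> rcases w with ⟨N, w⟩ | N | N <;> dsimp only [glueMap] at h
      · obtain rfl := π.injective (eq_of_glueAdj_sub_sub h)
        exact .sub M v w (((G M).adj v w).1 (glue_adj_sub_sub.1 h))
      · cases h
      · replace h := SimpleGraph.Adj.symm (G := (glueTree Y Q S).graph) h
        obtain rfl := π.injective (eq_of_glueAdj_top_sub h)
        exact .root_top N v ((hroot N v).1 (glue_adj_top_sub.1 h))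
      · cases h
      · exact .quot M N ((hπ M N).1 (glue_adj_quot_quot.1 h))
      · cases h
      · obtain rfl := π.injective (eq_of_glueAdj_top_sub h)
        exact .top_root M w ((hroot M w).1 (glue_adj_top_sub.1 h))
      · cases h
      · cases h
    · intro h
      cases h with
      | sub M v w h => exact .sub _ _ _ (((G M).adj v w).2 h)
      | quot M N h => exact .quot _ _ ((hπ M N).2 h)
      | top_root M v h => exact .top_root _ _ ((hroot M v).2 h)
      | root_top M v h => exact .root_top _ _ ((hroot M v).2 h)
  treeEdge v w := by
    change GlueTreeEdge Q S (glueMap π _ v) (glueMap π _ w) ↔ GlueTreeEdge P T v w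
    constructor
    · intro h
      rcases v with ⟨M, v⟩ | M | M <;> rcases w with ⟨N, w⟩ | N | N <;> dsimp only [glueMap] at h
      · obtain rfl := π.injective (eq_of_glueTreeEdge_sub_sub h)
        exact .sub M v w (((G M).treeEdge v w).1 (glue_treeEdge_sub_sub (X := Y).1 h))
      · cases h
      · cases h
      · cases h
      · cases h
      · have := glue_treeEdge_quot (X := Y).1 h
        injection this with this
        obtain rfl := π.injective this
        exact .new _
      · cases h
      · cases h
      · cases h
    · intro h
      cases h with
      | sub M v w h => exact .sub _ _ _ (((G M).treeEdge v w).2 h)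
      | new M => exact .new _

end glueIso

/-! ### Isomorphisms of graphs and of their modular trees -/

namespace IsModularTree

theorem isPrime_or_isDegenerate_of_iso {X : SimpleGraph V} {Y : SimpleGraph W} (f : X ≃g Y)
    (h : IsPrime X ∨ IsDegenerate X) : IsPrime Y ∨ IsDegenerate Y :=
  h.imp (.of_iso f) (.of_iso f)

theorem exists_iso {X : SimpleGraph V} {T : MarkedGraph.{u}} {ι : V → T.Vert}
    (hX : IsModularTree X T ι) {Y : SimpleGraph W} {S : MarkedGraph.{u}} {κ : W → S.Vert}
    (hY : IsModularTree Y S κ) (f : X ≃g Y) : ∃ F : T.Iso S, ∀ x, F.toEquiv (ι x) = κ (f x) := by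
  induction hX generalizing W S with
  | leaf X h =>
    cases hY with
    | leaf _ _ =>
      exact ⟨⟨f.toEquiv, fun _ => Iff.rfl, fun _ _ => f.map_adj_iff, fun _ _ => Iff.rfl⟩,
        fun _ => rfl⟩
    | glue _ h' => exact (h' (isPrime_or_isDegenerate_of_iso f h)).elim
  | glue X h hP T ι hT κ hκ ih =>
    cases hY with
    | leaf _ h' => exact (h (isPrime_or_isDegenerate_of_iso f.symm h')).elim
    | glue _ h' hQ S ι' hS κ' hκ' =>
      choose G hG using fun M => ih M (hS (partMap f M)) (partIso f M)
      refine ⟨glueIso (fun M => (hT M).mem_root_iff) (fun N => (hS N).mem_root_iff) (partMap f)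
        (quotientGraph_adj_partMap f) G, fun x => ?_⟩
      obtain ⟨M, hM, hx⟩ := hP.cover x
      have h1 := hκ' (partMap f ⟨M, hM⟩) (partIso f ⟨M, hM⟩ ⟨x, hx⟩)
      rw [partIso_val] at h1
      rw [hκ ⟨M, hM⟩ ⟨x, hx⟩, h1, ← hG]
      rfl

theorem eq_of_forall_apply_eq {X : SimpleGraph V} {T : MarkedGraph.{u}} {ι : V → T.Vert}
    (hX : IsModularTree X T ι) (F : T.Iso T) (hF : ∀ x, F.toEquiv (ι x) = ι x) (v : T.Vert) :
    F.toEquiv v = v := by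
  induction hX with
  | leaf X h => exact hF v
  | glue X h hP T ι hT κ hκ ih =>
    have hlink := fun M => (hT M).exists_link_root
    have hroot := fun M => (hT M).mem_root_iff
    have hsub : ∀ M x, F.toEquiv (.sub M (ι M x)) = .sub M (ι M x) := fun M x => by
      have := hF x
      rwa [hκ] at this
    have hquot : ∀ M, F.toEquiv (.quot M) = .quot M := fun M => by
      obtain ⟨N, hN⟩ := glueIso_quot hroot hroot F M
      obtain ⟨x, hx⟩ := hP.nonempty M M.2
      obtain ⟨w, hw⟩ := glueIso_sub hlink F hN (ι M ⟨x, hx⟩)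
      have h1 := (hsub M ⟨x, hx⟩).symm.trans hw
      injection h1 with h1
      rw [hN, h1]
    cases v with
    | quot M => exact hquot M
    | top M => exact glueIso_top F (hquot M)
    | sub M v =>
      obtain ⟨G, hG⟩ := glueIso_restrict hlink hlink F (hquot M)
      have h1 : G.toEquiv v = v := ih M G (fun x => by
        have := (hG _).symm.trans (hsub M x)
        injection this) v
      rw [hG, h1]

theorem not_isMarker_apply {X : SimpleGraph V} {T : MarkedGraph.{u}} {ι : V → T.Vert}
    (hX : IsModularTree X T ι) (x : V) : ¬ T.IsMarker (ι x) :=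
  (hX.exists_apply_eq_iff _).1 ⟨x, rfl⟩

theorem exists_isMarker {X : SimpleGraph V} (h : ¬ (IsPrime X ∨ IsDegenerate X))
    (hP : IsCongruence X (modularPartition X)) (T : modularPartition X → MarkedGraph.{u}) :
    ∃ v, (glueTree X (modularPartition X) T).IsMarker v := by
  rcases isEmpty_or_nonempty V with _ | ⟨⟨x⟩⟩
  · exact (h (.inr (.inr (Subsingleton.elim _ _)))).elim
  · obtain ⟨M, hM, -⟩ := hP.cover x
    exact ⟨.quot ⟨M, hM⟩, trivial⟩

theorem adj_iff_of_iso {X : SimpleGraph V} {T : MarkedGraph.{u}} {ι : V → T.Vert}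
    (hX : IsModularTree X T ι) {Y : SimpleGraph W} {S : MarkedGraph.{u}} {κ : W → S.Vert}
    (hY : IsModularTree Y S κ) (F : T.Iso S) {x x' : V} {y y' : W} (hy : F.toEquiv (ι x) = κ y)
    (hy' : F.toEquiv (ι x') = κ y') : Y.Adj y y' ↔ X.Adj x x' := by
  induction hX generalizing W S with
  | leaf X h =>
    cases hY with
    | leaf _ _ => exact F.adj_iff hy hy'
    | glue _ h' hQ S _ _ _ _ =>
      obtain ⟨v, hv⟩ := exists_isMarker h' hQ S
      exact ((F.symm.marker v).2 hv).elim
  | glue X h hP T ι hT κ hκ ih =>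
    cases hY with
    | leaf _ _ =>
      obtain ⟨v, hv⟩ := exists_isMarker h hP T
      exact ((F.marker v).2 hv).elim
    | glue _ h' hQ S ι' hS κ' hκ' =>
      have hlink := fun M => (hT M).exists_link_root
      have hroot := fun M => (hT M).mem_root_iff
      have hlink' := fun N => (hS N).exists_link_root
      have hroot' := fun N => (hS N).mem_root_iff
      have key : ∀ {x y}, F.toEquiv (κ x) = κ' y → ∀ {M N}, x ∈ M.1 →
          F.toEquiv (.quot M) = .quot N → y ∈ N.1 := by
        intro x y hxy M N hx hMN
        obtain ⟨w, hw⟩ := glueIso_sub hlink F hMN (ι M ⟨x, hx⟩)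
        obtain ⟨N', hN', hyN'⟩ := hQ.cover y
        rw [hκ M ⟨x, hx⟩, hκ' ⟨N', hN'⟩ ⟨y, hyN'⟩, hw] at hxy
        injection hxy with h1
        rw [h1]
        exact hyN'
      obtain ⟨M, hM, hx⟩ := hP.cover x
      obtain ⟨M', hM', hx'⟩ := hP.cover x'
      obtain ⟨N, hMN⟩ := glueIso_quot hroot hroot' F ⟨M, hM⟩
      obtain ⟨N', hMN'⟩ := glueIso_quot hroot hroot' F ⟨M', hM'⟩
      have hyN := key hy hx hMN
      have hyN' := key hy' hx' hMN'
      by_cases hMM' : M = M'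
      · subst hMM'
        have hNN' := hMN.symm.trans hMN'
        injection hNN' with hNN'
        subst hNN'
        obtain ⟨G, hG⟩ := glueIso_restrict hlink hlink' F hMN
        have hG' : ∀ {x y} (hx : x ∈ M) (hy : y ∈ N.1), F.toEquiv (κ x) = κ' y →
            G.toEquiv (ι ⟨M, hM⟩ ⟨x, hx⟩) = ι' N ⟨y, hy⟩ := by
          intro x y hx hy hxy
          rw [hκ ⟨M, hM⟩ ⟨x, hx⟩, hκ' N ⟨y, hy⟩, hG] at hxy
          injection hxy
        exact ih ⟨M, hM⟩ (hS N) G (hG' hx hyN hy) (hG' hx' hyN' hy')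
      · have hne : (⟨M, hM⟩ : modularPartition X) ≠ ⟨M', hM'⟩ :=
          fun h => hMM' (congrArg Subtype.val h)
        have hne' : N ≠ N' := fun h => hne <| by
          subst h
          have := F.toEquiv.injective (hMN.trans hMN'.symm)
          injection this
        rw [← hQ.quotientGraph_adj hne' hyN hyN', ← hP.quotientGraph_adj hne hx hx']
        exact glue_adj_quot_quot.symm.trans ((F.adj_iff hMN hMN').trans glue_adj_quot_quot)

/-- An isomorphism of modular trees induces an isomorphism of graphs. -/
theorem exists_graphIso {X : SimpleGraph V} {T : MarkedGraph.{u}} {ι : V → T.Vert}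
    (hX : IsModularTree X T ι) {Y : SimpleGraph W} {S : MarkedGraph.{u}} {κ : W → S.Vert}
    (hY : IsModularTree Y S κ) (F : T.Iso S) : ∃ f : X ≃g Y, ∀ x, F.toEquiv (ι x) = κ (f x) := by
  have h1 : ∀ x, ∃ y, κ y = F.toEquiv (ι x) := fun x =>
    (hY.exists_apply_eq_iff _).2 fun h => hX.not_isMarker_apply x ((F.marker _).1 h)
  choose f hf using h1
  refine ⟨⟨Equiv.ofBijective f ⟨fun x x' h => ?_, fun y => ?_⟩,
    adj_iff_of_iso hX hY F (hf _).symm (hf _).symm⟩, fun x => (hf x).symm⟩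
  · exact hX.injective (F.toEquiv.injective ((hf x).symm.trans ((congrArg κ h).trans (hf x'))))
  · obtain ⟨x, hx⟩ := (hX.exists_apply_eq_iff (F.symm.toEquiv (κ y))).2
      fun h => hY.not_isMarker_apply y ((F.symm.marker _).1 h)
    refine ⟨x, hY.injective ((hf x).trans ?_)⟩
    rw [hx]
    exact F.toEquiv.apply_symm_apply _

end IsModularTree

/-- An automorphism of a marked graph as an isomorphism. -/
def MarkedGraph.isoOfAut {T : MarkedGraph.{u}} (σ : T.Aut) : T.Iso T :=
  ⟨σ.1, σ.2.1, σ.2.2.1, σ.2.2.2⟩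

/-- The automorphisms of a graph are those of any of its modular trees. -/
theorem IsModularTree.nonempty_mulEquiv {X : SimpleGraph V} {T : MarkedGraph.{u}} {ι : V → T.Vert}
    (h : IsModularTree X T ι) : Nonempty ((X ≃g X) ≃* T.Aut) := by
  choose r hr using fun σ : T.Aut => h.exists_graphIso h (MarkedGraph.isoOfAut σ)
  replace hr : ∀ (σ : T.Aut) x, σ.1 (ι x) = ι (r σ x) := hr
  have hinj : Function.Injective r := by
    intro σ τ hστ
    refine Subtype.ext (Equiv.ext fun v => ?_)
    have h1 : ∀ x, (τ⁻¹ * σ).1 (ι x) = ι x := fun x => by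
      change τ.1⁻¹ (σ.1 (ι x)) = ι x
      rw [hr, hστ, ← hr]
      exact τ.1.symm_apply_apply _
    exact Equiv.Perm.inv_eq_iff_eq.1
      (h.eq_of_forall_apply_eq (MarkedGraph.isoOfAut (τ⁻¹ * σ)) h1 v)
  have hsurj : Function.Surjective r := by
    intro f
    obtain ⟨F, hF⟩ := h.exists_iso h f
    refine ⟨⟨F.toEquiv, F.marker, F.adj, F.treeEdge⟩, RelIso.ext fun x => h.injective ?_⟩
    rw [← hr, ← hF]
  refine ⟨(MulEquiv.mk' (Equiv.ofBijective r ⟨hinj, hsurj⟩) fun σ τ => ?_).symm⟩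
  refine RelIso.ext fun x => h.injective ?_
  change ι (r (σ * τ) x) = ι (r σ (r τ x))
  rw [← hr, ← hr, ← hr]
  rfl

end ModularDecomposition

theorem mainTheorem6 {V : Type*} [Finite V] (X : SimpleGraph V) :
    Nonempty ((X ≃g X) ≃* (ModularDecomposition.modularTree X).Aut) := by
  obtain ⟨ι, h⟩ := ModularDecomposition.exists_isModularTree X
  exact h.nonempty_mulEquiv
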